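/- For an infinite sequence $t=(t_n)_{n\ge 1}$ over $\{1,2\}$, the sequence directed by $t$ is the infinite sequence $\mathcal{O}_t=(x_n)_{n\ge 1}$ obtained by writing consecutive blocks, where for every $i\ge 1$ the $i$-th block has length $x_i$ and all its letters are equal to $t_i$. (Explicitly: start from the empty word; at step $i$ append the letter $t_i$ once, and then append $x_i-1$ further copies of $t_i$, where $x_i$ is the $i$-th letter of the word written so far, including the copy of $t_i$ just appended.) Let $p\in\,]0,1[$ and let $\mathbb{T}=(T_n)_{n\ge 1}$ be a Markov chain over the alphabet $\{1,2\}$ with initial value $T_1=1$ whose transition probability from $1$ to $2$, and from $2$ to $1$, is $p$. Let $\mathbb{X}=(X_n)_{n\ge 1}=\mathcal{O}_{\mathbb{T}}$ be the random sequence directed by $\mathbb{T}$. Then $$\lim_{n\to\infty}\mathbb{P}(X_n=1)=\frac12 .$$ -/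

import Mathlib

open MeasureTheory ProbabilityTheory Filter Topology

namespace DirectedSequence

/-- One construction step: `w` is the word written so far after `k` letters of the directing
sequence have been read, and `x` is the next directing letter. The letter `x` is written once,
then `w[k] - 1` further copies are written, where `w[k]` (counted from `0`, and read after the
first copy of `x` has been written) is the prescribed length of the new block. -/
def writeBlock (k : ℕ) (w : List ℕ) (x : ℕ) : List ℕ :=
  (w ++ [x]) ++ List.replicate ((w ++ [x]).getD k 0 - 1) x

/-- The finite word directed by the first `k` letters `t 0, …, t (k - 1)` of the directing
sequence `t`. -/
def directedWord (t : ℕ → ℕ) : ℕ → List ℕ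
  | 0 => []
  | k + 1 => writeBlock k (directedWord t k) (t k)

/-- The infinite sequence directed by `t`: the limit of the words `directedWord t k`, each of which
is a prefix of the next one. Indices start at `0`. The word `directedWord t (n + 1)` has at least
`n + 1` letters, and its letter of index `n` no longer changes afterwards
(`directedWord_getElem?`). -/
def directedSeq (t : ℕ → ℕ) (n : ℕ) : ℕ :=
  (directedWord t (n + 1)).getD n 0

theorem le_length_directedWord (t : ℕ → ℕ) (k : ℕ) : k ≤ (directedWord t k).length := by
  induction k with
  | zero => simp
  | succ k ih =>
    simp only [directedWord, writeBlock, List.length_append, List.length_cons, List.length_nil]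
    omega

theorem directedWord_prefix (t : ℕ → ℕ) {k m : ℕ} (h : k ≤ m) :
    directedWord t k <+: directedWord t m := by
  induction m, h using Nat.le_induction with
  | base => exact List.prefix_rfl
  | succ m _ ih =>
    refine ih.trans ?_
    simp only [directedWord, writeBlock, List.append_assoc]
    exact List.prefix_append _ _

theorem directedWord_getElem? (t : ℕ → ℕ) {n m : ℕ} (h : n < m) :
    (directedWord t m)[n]? = some (directedSeq t n) := by
  have hl : n < (directedWord t (n + 1)).length := le_length_directedWord t (n + 1)
  obtain ⟨s, hs⟩ := directedWord_prefix t (Nat.succ_le_of_lt h)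
  rw [← hs, List.getElem?_append_left hl]
  simp [directedSeq, List.getD_eq_getElem?_getD, List.getElem?_eq_getElem hl]

/-- `T 0, T 1, …` is a time-homogeneous Markov chain under `P` over the (discrete) alphabet `A`,
with transition probabilities `Q a b` from `a` to `b`: conditionally on any past
`T 0 = x 0, …, T n = x n` of positive probability, `T (n + 1)` equals `b` with probability
`Q (x n) b`. -/
structure IsMarkovChain {Ω S : Type*} [MeasurableSpace Ω] [MeasurableSpace S]
    (P : Measure Ω) (A : Set S) (Q : S → S → ℝ) (T : ℕ → Ω → S) : Prop where
  measurable : ∀ n, Measurable (T n)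
  mem_alphabet : ∀ n, ∀ᵐ ω ∂P, T n ω ∈ A
  markov : ∀ (n : ℕ) (x : ℕ → S), (∀ i ≤ n, x i ∈ A) → ∀ b ∈ A,
    P {ω | ∀ i ≤ n, T i ω = x i} ≠ 0 →
      (cond P {ω | ∀ i ≤ n, T i ω = x i}).real {ω | T (n + 1) ω = b} = Q (x n) b

/-- Transition probabilities of the symmetric two-state chain: the letter changes with probability
`p` and stays the same with probability `1 - p`. -/
def flipTransition (p : ℝ) (a b : ℕ) : ℝ :=
  if a = b then 1 - p else p

end DirectedSequence

/-! The letter of index `n` is `T k`, where `k` is the index of its block, and the length of that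
block is the letter of index `k`, itself written in an earlier or equal block `j`. Block boundaries
up to the end of block `k` use only the letters of index at most `k`, all written by blocks up to
`j`. Hence the event that `n` leads to `k` and `k` leads to `j` depends only on `T 0, …, T j`
(`HasBlocks.congr`).

Code the letters 1 and 2 by the signs 1 and -1. Each step of the chain multiplies the conditional
mean sign by `1 - 2 * p`, so the expected sign of the letter of index `n` is the expectation of `(1
- 2 * p) ^ (k - j)` times the sign of `T j` (`integral_letterSign_directedSeq`).

Almost surely the letter 2 recurs, so the written word gets arbitrarily far ahead of the directing
sequence and `k - j` tends to infinity (`tendsto_blockIndex_sub`). As `|1 - 2 * p| < 1`, dominated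
convergence sends the expected sign to 0, which is the claim. -/

namespace DirectedSequence

/-! ### Combinatorics of directed sequences -/

/-- The number of letters written by the first `k` blocks. -/
def wordLength (t : ℕ → ℕ) (k : ℕ) : ℕ := (directedWord t k).length

theorem wordLength_succ (t : ℕ → ℕ) (k : ℕ) :
    wordLength t (k + 1) = wordLength t k + 1 + (directedSeq t k - 1) := by
  have hk := le_length_directedWord t k
  -- The first copy of `t k` brings the length to at least `k + 1`, so the default 0 is never read
  -- and further copies leave this entry alone.
  have h : (directedWord t k ++ [t k]).getD k 0 = directedSeq t k := by
    rw [directedSeq, directedWord, writeBlock]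
    exact (List.getD_append _ _ _ _ (by simp; omega)).symm
  simp only [wordLength, directedWord, writeBlock, List.length_append, List.length_replicate, h,
    List.length_cons, List.length_nil]

theorem wordLength_strictMono (t : ℕ → ℕ) : StrictMono (wordLength t) :=
  strictMono_nat_of_lt_succ fun k => by rw [wordLength_succ]; omega

theorem directedSeq_eq_of_mem_block (t : ℕ → ℕ) {n k : ℕ} (h1 : wordLength t k ≤ n)
    (h2 : n < wordLength t (k + 1)) : directedSeq t n = t k := by
  have hmem : directedSeq t n ∈ (directedWord t (k + 1)).drop (wordLength t k) := by
    rw [List.mem_iff_getElem?]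
    refine ⟨n - wordLength t k, ?_⟩
    rw [List.getElem?_drop, Nat.add_sub_cancel' h1]
    have hn : n < (directedWord t (n + 1)).length := le_length_directedWord t (n + 1)
    have hkn : k ≤ n := ((wordLength_strictMono t).le_apply).trans h1
    obtain ⟨s, hs⟩ := directedWord_prefix t (Nat.succ_le_succ hkn)
    rw [← directedWord_getElem? t (Nat.lt_succ_self n), ← hs, List.getElem?_append_left h2]
  simp only [directedWord, writeBlock, wordLength, List.append_assoc, List.drop_left,
    List.mem_append, List.mem_singleton, List.mem_replicate] at hmem
  rcases hmem with h | h
  · exact h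
  · exact h.2

/-- The index of the block which contains the letter of index `n`. -/
def blockIndex (t : ℕ → ℕ) (n : ℕ) : ℕ := Nat.findGreatest (fun k => wordLength t k ≤ n) n

theorem wordLength_blockIndex_le (t : ℕ → ℕ) (n : ℕ) : wordLength t (blockIndex t n) ≤ n :=
  Nat.findGreatest_spec (P := fun k => wordLength t k ≤ n) (Nat.zero_le n)
    (by simp [wordLength, directedWord])

theorem blockIndex_le (t : ℕ → ℕ) (n : ℕ) : blockIndex t n ≤ n := Nat.findGreatest_le n

theorem lt_wordLength_blockIndex (t : ℕ → ℕ) (n : ℕ) : n < wordLength t (blockIndex t n + 1) := by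
  rcases (blockIndex_le t n).lt_or_eq with h | h
  · exact not_le.1 (Nat.findGreatest_is_greatest (P := fun k => wordLength t k ≤ n)
      (Nat.lt_succ_self _) h)
  · rw [h]
    exact (wordLength_strictMono t).le_apply

theorem blockIndex_eq (t : ℕ → ℕ) {n k : ℕ} (h1 : wordLength t k ≤ n)
    (h2 : n < wordLength t (k + 1)) : blockIndex t n = k := by
  have hm := wordLength_strictMono t
  have h3 := hm.lt_iff_lt.1 ((wordLength_blockIndex_le t n).trans_lt h2)
  have h4 := hm.lt_iff_lt.1 (h1.trans_lt (lt_wordLength_blockIndex t n))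
  omega

theorem directedSeq_eq (t : ℕ → ℕ) (n : ℕ) : directedSeq t n = t (blockIndex t n) :=
  directedSeq_eq_of_mem_block t (wordLength_blockIndex_le t n) (lt_wordLength_blockIndex t n)

/-! ### Dependence on finitely many directing letters -/

theorem directedWord_congr {t u : ℕ → ℕ} {k : ℕ} (h : ∀ i < k, t i = u i) :
    directedWord t k = directedWord u k := by
  induction k with
  | zero => rfl
  | succ k ih => simp only [directedWord, ih fun i hi => h i (by omega), h k (by omega)]

theorem directedSeq_congr {t u : ℕ → ℕ} {j n : ℕ} (h : ∀ i ≤ j, t i = u i)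
    (hn : n < wordLength t (j + 1)) : directedSeq t n = directedSeq u n := by
  have hw : directedWord t (j + 1) = directedWord u (j + 1) :=
    directedWord_congr fun i hi => h i (by omega)
  -- Whether or not `n ≤ j`, one of the words after `n + 1` and `j + 1` blocks is a prefix of the
  -- other.
  have key : ∀ v : ℕ → ℕ, n < wordLength v (j + 1) →
      (directedWord v (j + 1))[n]? = some (directedSeq v n) := fun v hv => by
    rcases lt_or_ge n (j + 1) with hj | hj
    · exact directedWord_getElem? v hj
    · obtain ⟨s, hs⟩ := directedWord_prefix v (hj.trans n.le_succ)
      rw [← directedWord_getElem? v (Nat.lt_succ_self n), ← hs, List.getElem?_append_left hv]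
  have h1 := key t hn
  have h2 := key u (by rwa [wordLength, ← hw])
  rw [hw, h2] at h1
  exact (Option.some.inj h1).symm

/-- The first `k + 1` block lengths are the letters of index at most `k`, and the first `j + 1`
blocks already contain these. The boundaries are thus known possibly well before the directing
letter `t k` is read. -/
theorem wordLength_congr {t u : ℕ → ℕ} {j k m : ℕ} (h : ∀ i ≤ j, t i = u i)
    (hk : k < wordLength t (j + 1)) (hm : m ≤ k + 1) : wordLength t m = wordLength u m := by
  induction m with
  | zero => rfl
  | succ m ih =>
    rw [wordLength_succ, wordLength_succ, ih (by omega), directedSeq_congr h (by omega)]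

theorem blockIndex_congr {t u : ℕ → ℕ} {j k n : ℕ} (h : ∀ i ≤ j, t i = u i)
    (hk : k < wordLength t (j + 1)) (hn : blockIndex t n ≤ k) :
    blockIndex u n = blockIndex t n := by
  apply blockIndex_eq
  · rw [← wordLength_congr h hk (by omega)]
    exact wordLength_blockIndex_le t n
  · rw [← wordLength_congr h hk (by omega)]
    exact lt_wordLength_blockIndex t n

theorem dependsOn_directedSeq (n : ℕ) : DependsOn (fun t => directedSeq t n) (Set.Iic n) :=
  fun t _ h => directedSeq_congr (j := n) h (wordLength_strictMono t).le_apply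

theorem dependsOn_blockIndex (n : ℕ) : DependsOn (fun t => blockIndex t n) (Set.Iic n) :=
  fun t _ h => (blockIndex_congr (j := n) h (wordLength_strictMono t).le_apply
    (blockIndex_le t n)).symm

/-- The letter of index `n` lies in the block of index `k`, whose length is prescribed by a letter
of the block of index `j`. -/
def HasBlocks (n j k : ℕ) (t : ℕ → ℕ) : Prop := blockIndex t n = k ∧ blockIndex t k = j

theorem HasBlocks.congr {n j k : ℕ} {t u : ℕ → ℕ} (ht : HasBlocks n j k t)
    (h : ∀ i ≤ j, t i = u i) : HasBlocks n j k u := by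
  obtain ⟨h1, h2⟩ := ht
  have hk : k < wordLength t (j + 1) := h2 ▸ lt_wordLength_blockIndex t k
  exact ⟨(blockIndex_congr h hk h1.le).trans h1,
    (blockIndex_congr h hk (blockIndex_le t k)).trans h2⟩

open scoped Classical in
theorem dependsOn_hasBlocks (n j k : ℕ) :
    DependsOn (fun t => if HasBlocks n j k t then (1 : ℝ) else 0) (Set.Iic j) := by
  intro t u h
  have : HasBlocks n j k t ↔ HasBlocks n j k u :=
    ⟨fun ht => ht.congr h, fun hu => hu.congr fun i hi => (h i hi).symm⟩
  simp [this]

/-! ### Growth -/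

theorem wordLength_le {t : ℕ → ℕ} (ht : ∀ i, t i = 1 ∨ t i = 2) (k : ℕ) :
    wordLength t k ≤ 2 * k := by
  induction k with
  | zero => simp [wordLength, directedWord]
  | succ k ih =>
    rw [wordLength_succ, directedSeq_eq]
    rcases ht (blockIndex t k) with h | h <;> omega

theorem lt_two_mul_blockIndex {t : ℕ → ℕ} (ht : ∀ i, t i = 1 ∨ t i = 2) (n : ℕ) :
    n < 2 * (blockIndex t n + 1) :=
  (lt_wordLength_blockIndex t n).trans_le (wordLength_le ht _)

/-- Every block has at least one letter, so the lead `wordLength t i - i` never decreases. -/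
theorem add_le_wordLength_of_le {t : ℕ → ℕ} {M j : ℕ} (h : j + M ≤ wordLength t j) {i : ℕ}
    (hi : j ≤ i) : i + M ≤ wordLength t i := by
  induction i, hi using Nat.le_induction with
  | base => exact h
  | succ i _ ih => rw [wordLength_succ]; omega

theorem exists_add_le_wordLength {t : ℕ → ℕ} (h2 : ∀ m, ∃ i ≥ m, t i = 2) (M : ℕ) :
    ∃ j, j + M ≤ wordLength t j := by
  induction M with
  | zero => exact ⟨0, Nat.zero_le _⟩
  | succ M ih =>
    obtain ⟨j, hj⟩ := ih
    obtain ⟨i, hi, hti⟩ := h2 j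
    -- Block `i` starts at index `wordLength t i` with the letter 2, so the block having that index
    -- has length 2 and increases the lead by one.
    have hx : directedSeq t (wordLength t i) = 2 :=
      (directedSeq_eq_of_mem_block t le_rfl (wordLength_strictMono t i.lt_succ_self)).trans hti
    refine ⟨wordLength t i + 1, ?_⟩
    have h1 : i ≤ wordLength t i := (wordLength_strictMono t).le_apply
    have h3 := add_le_wordLength_of_le hj (hi.trans h1)
    rw [wordLength_succ, hx]
    omega

theorem tendsto_blockIndex_sub {t : ℕ → ℕ} (ht : ∀ i, t i = 1 ∨ t i = 2)
    (h2 : ∀ m, ∃ i ≥ m, t i = 2) :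
    Tendsto (fun n => blockIndex t n - blockIndex t (blockIndex t n)) atTop atTop := by
  refine tendsto_atTop.2 fun M => ?_
  obtain ⟨j, hj⟩ := exists_add_le_wordLength h2 M
  -- Passing to the block index at worst roughly halves an index; it is done twice, so this
  -- threshold keeps the second block index above `j`.
  filter_upwards [eventually_ge_atTop (4 * (j + 1))] with n hn
  have h1 := lt_two_mul_blockIndex ht n
  have h3 := lt_two_mul_blockIndex ht (blockIndex t n)
  have h4 := wordLength_blockIndex_le t (blockIndex t n)
  have h5 := add_le_wordLength_of_le hj (i := blockIndex t (blockIndex t n)) (by omega)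
  omega

/-! ### The directing Markov chain -/

/-- The sign `1` of the letter `1`, and `-1` of any other letter. -/
def letterSign (a : ℕ) : ℝ := if a = 1 then 1 else -1

theorem norm_letterSign (a : ℕ) : ‖letterSign a‖ = 1 := by
  unfold letterSign; split_ifs <;> simp

/-- The sequence which repeats the last letter of a finite word of length `k + 1`. -/
def extendWord (k : ℕ) (x : Fin (k + 1) → ℕ) (i : ℕ) : ℕ := x ⟨min i k, by omega⟩

theorem extendWord_apply {k : ℕ} (t : ℕ → ℕ) {i : ℕ} (hi : i ≤ k) :
    extendWord k (fun m => t m) i = t i := by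
  simp [extendWord, hi]

variable {Ω : Type*} [MeasurableSpace Ω]

theorem measurable_of_dependsOn {β : Type*} [MeasurableSpace β] {T : ℕ → Ω → ℕ}
    (hT : ∀ n, Measurable (T n)) {F : (ℕ → ℕ) → β} {k : ℕ} (hF : DependsOn F (Set.Iic k)) :
    Measurable fun ω => F fun i => T i ω := by
  have h : (fun ω => F fun i => T i ω) =
      (fun x => F (extendWord k x)) ∘ fun ω (m : Fin (k + 1)) => T m ω := by
    funext ω
    exact hF fun i hi => (extendWord_apply (fun i => T i ω) hi).symm
  rw [h]
  exact (Measurable.of_discrete (f := fun x => F (extendWord k x))).comp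
    (measurable_pi_lambda _ fun m => hT m)

theorem IsMarkovChain.congr {S : Type*} [MeasurableSpace S] {P : Measure Ω} {A : Set S}
    {Q : S → S → ℝ} {T U : ℕ → Ω → S} (hT : IsMarkovChain P A Q T)
    (hU : ∀ n, Measurable (U n)) (h : ∀ n, T n =ᵐ[P] U n) : IsMarkovChain P A Q U := by
  have h' : ∀ᵐ ω ∂P, ∀ n, T n ω = U n ω := ae_all_iff.2 h
  refine ⟨hU, fun n => ?_, fun n x hx b hb h0 => ?_⟩
  · filter_upwards [hT.mem_alphabet n, h'] with ω h1 h2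
    rwa [← h2]
  · have hc : {ω | ∀ i ≤ n, U i ω = x i} =ᵐ[P] {ω | ∀ i ≤ n, T i ω = x i} := by
      refine eventuallyEq_set.2 ?_
      filter_upwards [h'] with ω h2
      simp only [h2]
    have hcond : cond P {ω | ∀ i ≤ n, U i ω = x i} = cond P {ω | ∀ i ≤ n, T i ω = x i} := by
      rw [ProbabilityTheory.cond, ProbabilityTheory.cond, measure_congr hc, Measure.restrict_congr_set hc]
    have hb' : {ω | U (n + 1) ω = b} =ᵐ[cond P {ω | ∀ i ≤ n, T i ω = x i}]
        {ω | T (n + 1) ω = b} := by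
      refine eventuallyEq_set.2 (cond_absolutelyContinuous.ae_le ?_)
      filter_upwards [h'] with ω h2
      simp only [h2]
    rw [hcond, measureReal_congr hb']
    exact hT.markov n x hx b hb (by rwa [← measure_congr hc])

/-! ### Decay of the mean sign along the chain, and recurrence of the letter 2 -/

section Chain

variable {P : Measure Ω} [IsProbabilityMeasure P] {p : ℝ} {T : ℕ → Ω → ℕ}

/-- The sign is an eigenfunction of the transition matrix: its mean after one step is `(1 - p) - p`
times its current value. -/
theorem setIntegral_letterSign_succ (hT : IsMarkovChain P {1, 2} (flipTransition p) T)
    (k : ℕ) (x : ℕ → ℕ) (hx : ∀ i, x i = 1 ∨ x i = 2) :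
    ∫ ω in {ω | ∀ i ≤ k, T i ω = x i}, letterSign (T (k + 1) ω) ∂P =
      (1 - 2 * p) * ∫ ω in {ω | ∀ i ≤ k, T i ω = x i}, letterSign (T k ω) ∂P := by
  set C : Set Ω := {ω | ∀ i ≤ k, T i ω = x i} with hC
  have hCm : MeasurableSet C := by
    rw [hC, Set.ofPred_forall]
    refine MeasurableSet.iInter fun i => ?_
    rw [Set.ofPred_forall]
    exact MeasurableSet.iInter fun _ => hT.measurable i (measurableSet_singleton (x i))
  have hBm : MeasurableSet {ω | T (k + 1) ω = 1} :=
    hT.measurable (k + 1) (measurableSet_singleton 1)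
  have h1 : ∫ ω in C, letterSign (T k ω) ∂P = letterSign (x k) * P.real C := by
    rw [setIntegral_congr_fun (g := fun _ => letterSign (x k)) hCm
      fun ω hω => by simp only [hω k le_rfl]]
    simp [mul_comm]
  have h2 : ∫ ω in C, letterSign (T (k + 1) ω) ∂P =
      2 * P.real (C ∩ {ω | T (k + 1) ω = 1}) - P.real C := by
    have : (fun ω => letterSign (T (k + 1) ω)) =
        fun ω => 2 * Set.indicator {ω | T (k + 1) ω = 1} (fun _ => (1 : ℝ)) ω - 1 := by
      funext ω
      by_cases h : T (k + 1) ω = 1 <;> simp [letterSign, h] <;> norm_num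
    rw [this, integral_sub, integral_const_mul, integral_indicator hBm,
      Measure.restrict_restrict hBm, Set.inter_comm]
    · simp
    · exact ((integrable_const _).indicator hBm).const_mul _
    · exact integrable_const _
  rw [h1, h2]
  -- The Markov property says nothing about null cylinders, but there both sides vanish.
  by_cases h0 : P C = 0
  · have h3 : P (C ∩ {ω | T (k + 1) ω = 1}) = 0 := measure_mono_null Set.inter_subset_left h0
    simp [Measure.real, h0, h3]
  · have hm := hT.markov k x (fun i _ => by simpa using hx i) 1 (by simp) h0
    rw [← hC, measureReal_def, cond_apply hCm, ENNReal.toReal_mul, ENNReal.toReal_inv,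
      ← measureReal_def, ← measureReal_def] at hm
    have h0' : P.real C ≠ 0 := (measureReal_ne_zero_iff (by simp)).2 h0
    have h3 : P.real (C ∩ {ω | T (k + 1) ω = 1}) = P.real C * flipTransition p (x k) 1 := by
      rw [← hm]; field_simp
    rw [h3]
    rcases hx k with h | h <;> simp [h, flipTransition, letterSign] <;> ring

/-- The words of length `k + 1` over `{1, 2}` cut the space into finitely many cylinders, on each of
which `g` is constant. This replaces conditional expectation given the past. -/
theorem integral_mul_eq_sum (hTm : ∀ n, Measurable (T n))
    (hT12 : ∀ n ω, T n ω = 1 ∨ T n ω = 2) {k : ℕ} {g : (ℕ → ℕ) → ℝ}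
    (hg : DependsOn g (Set.Iic k)) (m : ℕ) :
    ∫ ω, g (fun i => T i ω) * letterSign (T m ω) ∂P =
      ∑ x ∈ Fintype.piFinset fun _ : Fin (k + 1) => ({1, 2} : Finset ℕ), g (extendWord k x) *
        ∫ ω in {ω | ∀ i ≤ k, T i ω = extendWord k x i}, letterSign (T m ω) ∂P := by
  have hCm : ∀ x : ℕ → ℕ, MeasurableSet {ω | ∀ i ≤ k, T i ω = x i} := fun x => by
    rw [Set.ofPred_forall]
    refine MeasurableSet.iInter fun i => ?_
    rw [Set.ofPred_forall]
    exact MeasurableSet.iInter fun _ => hTm i (measurableSet_singleton (x i))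
  have hint : Integrable (fun ω => letterSign (T m ω)) P :=
    Integrable.of_bound ((Measurable.of_discrete (f := letterSign)).comp
      (hTm m)).aestronglyMeasurable 1 (.of_forall fun ω => (norm_letterSign _).le)
  have hpt : ∀ ω, g (fun i => T i ω) * letterSign (T m ω) =
      ∑ x ∈ Fintype.piFinset fun _ : Fin (k + 1) => ({1, 2} : Finset ℕ), g (extendWord k x) *
        Set.indicator {ω | ∀ i ≤ k, T i ω = extendWord k x i}
          (fun ω => letterSign (T m ω)) ω := by
    intro ω
    rw [Finset.sum_eq_single fun i : Fin (k + 1) => T i ω]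
    · rw [Set.indicator_of_mem]
      · congr 1
        exact hg fun i hi => (extendWord_apply (fun i => T i ω) hi).symm
      · exact fun i hi => (extendWord_apply (fun i => T i ω) hi).symm
    · intro x _ hne
      rw [Set.indicator_of_notMem, mul_zero]
      intro hx
      refine hne (funext fun i => ?_)
      have := hx i (by omega)
      simp only [extendWord] at this
      rw [this]
      congr 1
      ext
      simp only
      omega
    · intro hx
      exact absurd (Fintype.mem_piFinset.2 fun i => by simpa using hT12 i ω) hx
  simp_rw [hpt]
  rw [integral_finsetSum _ fun x _ => (hint.indicator (hCm _)).const_mul _]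
  refine Finset.sum_congr rfl fun x _ => ?_
  rw [integral_const_mul, integral_indicator (hCm _)]

theorem integral_mul_letterSign_succ (hT : IsMarkovChain P {1, 2} (flipTransition p) T)
    (hT12 : ∀ n ω, T n ω = 1 ∨ T n ω = 2) {k : ℕ} {g : (ℕ → ℕ) → ℝ}
    (hg : DependsOn g (Set.Iic k)) :
    ∫ ω, g (fun i => T i ω) * letterSign (T (k + 1) ω) ∂P =
      (1 - 2 * p) * ∫ ω, g (fun i => T i ω) * letterSign (T k ω) ∂P := by
  rw [integral_mul_eq_sum hT.measurable hT12 hg, integral_mul_eq_sum hT.measurable hT12 hg,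
    Finset.mul_sum]
  refine Finset.sum_congr rfl fun x hx => ?_
  rw [setIntegral_letterSign_succ hT k (extendWord k x)
    fun i => by simpa using! Fintype.mem_piFinset.1 hx ⟨min i k, by omega⟩]
  ring

theorem integral_mul_letterSign_add (hT : IsMarkovChain P {1, 2} (flipTransition p) T)
    (hT12 : ∀ n ω, T n ω = 1 ∨ T n ω = 2) {j : ℕ} {g : (ℕ → ℕ) → ℝ}
    (hg : DependsOn g (Set.Iic j)) (m : ℕ) :
    ∫ ω, g (fun i => T i ω) * letterSign (T (j + m) ω) ∂P =
      (1 - 2 * p) ^ m * ∫ ω, g (fun i => T i ω) * letterSign (T j ω) ∂P := by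
  induction m with
  | zero => simp
  | succ m ih =>
    rw [← add_assoc, integral_mul_letterSign_succ hT hT12 (k := j + m)
      (fun t u h => hg fun i hi => h i (le_trans (Set.mem_Iic.1 hi) (Nat.le_add_right j m))), ih]
    ring

-- The window holds `N + 1` letters, hence `N` transitions from 1 to 1, each of probability `1 - p`.
open scoped Classical in
theorem measureReal_forall_eq_one (hT : IsMarkovChain P {1, 2} (flipTransition p) T)
    (hT12 : ∀ n ω, T n ω = 1 ∨ T n ω = 2) (hp1 : p < 1) (m N : ℕ) :
    P.real {ω | ∀ i, m ≤ i → i ≤ m + N → T i ω = 1} ≤ (1 - p) ^ N := by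
  induction N with
  | zero => simp
  | succ N ih =>
    set g : (ℕ → ℕ) → ℝ := fun t => if ∀ i, m ≤ i → i ≤ m + N → t i = 1 then 1 else 0 with hg
    have hdep : DependsOn g (Set.Iic (m + N)) := by
      intro t u h
      have : (∀ i, m ≤ i → i ≤ m + N → t i = 1) ↔ ∀ i, m ≤ i → i ≤ m + N → u i = 1 :=
        forall_congr' fun i => forall_congr' fun _ => forall_congr' fun hi => by rw [h i hi]
      simp only [hg, this]
    -- With `a N` the probability of the run, this identity reads `2 * a (N + 1) - a N = (1 - 2 * p)
    -- * a N`, so `a (N + 1) = (1 - p) * a N`.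
    have key := integral_mul_letterSign_succ hT hT12 hdep
    have hms : ∀ N, MeasurableSet {ω | ∀ i, m ≤ i → i ≤ m + N → T i ω = 1} := fun N => by
      simp only [Set.ofPred_forall]
      exact MeasurableSet.iInter fun i => MeasurableSet.iInter fun _ =>
        MeasurableSet.iInter fun _ => hT.measurable i (measurableSet_singleton 1)
    have e1 : ∀ ω, g (fun i => T i ω) * letterSign (T (m + N) ω) =
        Set.indicator {ω | ∀ i, m ≤ i → i ≤ m + N → T i ω = 1} 1 ω := by
      intro ω
      by_cases h : ∀ i, m ≤ i → i ≤ m + N → T i ω = 1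
      · rw [Set.indicator_of_mem (by exact h)]
        simp only [hg, if_pos h, letterSign, if_pos (h (m + N) (by omega) le_rfl)]
        simp
      · rw [Set.indicator_of_notMem (by exact h)]
        simp only [hg, if_neg h, zero_mul]
    have e2 : ∀ ω, g (fun i => T i ω) * letterSign (T (m + N + 1) ω) =
        2 * Set.indicator {ω | ∀ i, m ≤ i → i ≤ m + (N + 1) → T i ω = 1} 1 ω -
          Set.indicator {ω | ∀ i, m ≤ i → i ≤ m + N → T i ω = 1} 1 ω := by
      intro ω
      have hiff : (∀ i, m ≤ i → i ≤ m + (N + 1) → T i ω = 1) ↔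
          (∀ i, m ≤ i → i ≤ m + N → T i ω = 1) ∧ T (m + N + 1) ω = 1 := by
        refine ⟨fun h => ⟨fun i h1 h2 => h i h1 (by omega), h _ (by omega) (by omega)⟩,
          fun h i h1 h2 => ?_⟩
        rcases h2.lt_or_eq with h3 | h3
        · exact h.1 i h1 (by omega)
        · rw [h3]; exact h.2
      simp only [hg, Set.indicator, Set.mem_ofPred_eq, hiff, letterSign]
      by_cases h : ∀ i, m ≤ i → i ≤ m + N → T i ω = 1 <;>
        by_cases h' : T (m + N + 1) ω = 1
      · simp only [if_pos h, if_pos h', if_pos (And.intro h h'), Pi.one_apply]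
        norm_num
      · simp only [if_pos h, if_neg h', if_neg fun h2 : _ ∧ _ => h' h2.2, Pi.one_apply]
        norm_num
      all_goals
        simp only [if_neg h, if_neg fun h2 : _ ∧ _ => h h2.1]
        norm_num
    have hi : ∀ N, Integrable (Set.indicator {ω | ∀ i, m ≤ i → i ≤ m + N → T i ω = 1}
        (1 : Ω → ℝ)) P := fun N => (integrable_const (1 : ℝ)).indicator (hms N)
    simp_rw [e1, e2] at key
    rw [integral_sub ((hi _).const_mul 2) (hi _), integral_const_mul, integral_indicator_one (hms _),
      integral_indicator_one (hms _)] at key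
    have : P.real {ω | ∀ i, m ≤ i → i ≤ m + (N + 1) → T i ω = 1} =
        (1 - p) * P.real {ω | ∀ i, m ≤ i → i ≤ m + N → T i ω = 1} := by linarith
    rw [this, pow_succ, mul_comm]
    exact mul_le_mul_of_nonneg_right ih (by linarith)

theorem ae_frequently_eq_two (hT : IsMarkovChain P {1, 2} (flipTransition p) T)
    (hT12 : ∀ n ω, T n ω = 1 ∨ T n ω = 2) (hp0 : 0 < p) (hp1 : p < 1) :
    ∀ᵐ ω ∂P, ∀ m, ∃ i ≥ m, T i ω = 2 := by
  refine ae_all_iff.2 fun m => ?_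
  have hle : ∀ N : ℕ, P.real {ω | ¬ ∃ i ≥ m, T i ω = 2} ≤ (1 - p) ^ N := fun N => by
    refine le_trans (measureReal_mono ?_) (measureReal_forall_eq_one hT hT12 hp1 m N)
    rintro ω hω i hi -
    exact (hT12 i ω).resolve_right fun h => hω ⟨i, hi, h⟩
  have h0 : P.real {ω | ¬ ∃ i ≥ m, T i ω = 2} ≤ 0 :=
    ge_of_tendsto' (tendsto_pow_atTop_nhds_zero_of_lt_one (by linarith) (by linarith)) hle
  rw [ae_iff]
  exact (measureReal_eq_zero_iff (by simp)).1 (le_antisymm h0 measureReal_nonneg)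

/-! ### The letters of the directed sequence -/

-- Exactly one pair `(j, k)` satisfies `HasBlocks`, so random indices can be traded for a finite sum
-- over deterministic ones, to which the Markov property applies.
open scoped Classical in
theorem sum_hasBlocks (t : ℕ → ℕ) (n : ℕ) (f : ℕ → ℕ → ℝ) :
    ∑ k ∈ Finset.range (n + 1), ∑ j ∈ Finset.range (k + 1),
      (if HasBlocks n j k t then (1 : ℝ) else 0) * f j k =
      f (blockIndex t (blockIndex t n)) (blockIndex t n) := by
  have h1 := blockIndex_le t n
  have h2 := blockIndex_le t (blockIndex t n)
  rw [Finset.sum_eq_single_of_mem (blockIndex t n) (by simp; omega),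
    Finset.sum_eq_single_of_mem (blockIndex t (blockIndex t n)) (by simp; omega)]
  · simp [HasBlocks]
  · intro j _ hj
    rw [if_neg fun h => hj h.2.symm, zero_mul]
  · intro k _ hk
    refine Finset.sum_eq_zero fun j _ => ?_
    rw [if_neg fun h => hk h.1.symm, zero_mul]

open scoped Classical in
theorem integral_letterSign_directedSeq (hT : IsMarkovChain P {1, 2} (flipTransition p) T)
    (hT12 : ∀ n ω, T n ω = 1 ∨ T n ω = 2) (n : ℕ) :
    ∫ ω, letterSign (directedSeq (fun i => T i ω) n) ∂P =
      ∫ ω, (1 - 2 * p) ^ (blockIndex (fun i => T i ω) n -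
          blockIndex (fun i => T i ω) (blockIndex (fun i => T i ω) n)) *
        letterSign (T (blockIndex (fun i => T i ω) (blockIndex (fun i => T i ω) n)) ω) ∂P := by
  have hint : ∀ j k m, Integrable (fun ω =>
      (if HasBlocks n j k (fun i => T i ω) then (1 : ℝ) else 0) * letterSign (T m ω)) P := by
    intro j k m
    refine Integrable.of_bound (((measurable_of_dependsOn hT.measurable
      (dependsOn_hasBlocks n j k)).mul ((Measurable.of_discrete (f := letterSign)).comp
      (hT.measurable m))).aestronglyMeasurable) 1 (.of_forall fun ω => ?_)
    rw [norm_mul, norm_letterSign]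
    split_ifs <;> simp
  have e1 : ∀ ω, letterSign (directedSeq (fun i => T i ω) n) =
      ∑ k ∈ Finset.range (n + 1), ∑ j ∈ Finset.range (k + 1),
        (if HasBlocks n j k (fun i => T i ω) then (1 : ℝ) else 0) * letterSign (T k ω) :=
    fun ω => by
      rw [sum_hasBlocks (fun i => T i ω) n fun _ k => letterSign (T k ω), directedSeq_eq]
  have e2 : ∀ ω, (1 - 2 * p) ^ (blockIndex (fun i => T i ω) n -
          blockIndex (fun i => T i ω) (blockIndex (fun i => T i ω) n)) *
        letterSign (T (blockIndex (fun i => T i ω) (blockIndex (fun i => T i ω) n)) ω) =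
      ∑ k ∈ Finset.range (n + 1), ∑ j ∈ Finset.range (k + 1), (1 - 2 * p) ^ (k - j) *
        ((if HasBlocks n j k (fun i => T i ω) then (1 : ℝ) else 0) * letterSign (T j ω)) :=
    fun ω => by
      rw [← sum_hasBlocks (fun i => T i ω) n
        fun j k => (1 - 2 * p) ^ (k - j) * letterSign (T j ω)]
      exact Finset.sum_congr rfl fun k _ => Finset.sum_congr rfl fun j _ => by ring
  simp_rw [e1, e2]
  rw [integral_finsetSum _ fun k _ => integrable_finsetSum _ fun j _ => hint j k k,
    integral_finsetSum _ fun k _ => integrable_finsetSum _ fun j _ => (hint j k j).const_mul _]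
  refine Finset.sum_congr rfl fun k _ => ?_
  rw [integral_finsetSum _ fun j _ => hint j k k,
    integral_finsetSum _ fun j _ => (hint j k j).const_mul _]
  refine Finset.sum_congr rfl fun j hj => ?_
  have hjk : j ≤ k := by simpa [Nat.lt_succ_iff] using hj
  -- The event depends only on the letters up to `j`, so the sign can be carried from time `j` to
  -- time `k`.
  rw [integral_const_mul, ← integral_mul_letterSign_add hT hT12 (dependsOn_hasBlocks n j k) (k - j),
    Nat.add_sub_cancel' hjk]

theorem tendsto_integral_letterSign_directedSeq
    (hT : IsMarkovChain P {1, 2} (flipTransition p) T)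
    (hT12 : ∀ n ω, T n ω = 1 ∨ T n ω = 2) (hp0 : 0 < p) (hp1 : p < 1) :
    Tendsto (fun n => ∫ ω, letterSign (directedSeq (fun i => T i ω) n) ∂P) atTop (𝓝 0) := by
  have hr : |1 - 2 * p| < 1 := abs_lt.2 ⟨by linarith, by linarith⟩
  simp_rw [integral_letterSign_directedSeq hT hT12]
  rw [← integral_zero Ω ℝ (μ := P)]
  refine tendsto_integral_of_dominated_convergence (fun _ => 1) (fun n => ?_)
    (integrable_const _) (fun n => .of_forall fun ω => ?_) ?_
  · refine Measurable.aestronglyMeasurable (measurable_of_dependsOn hT.measurable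
      (F := fun t => (1 - 2 * p) ^ (blockIndex t n - blockIndex t (blockIndex t n)) *
        letterSign (t (blockIndex t (blockIndex t n)))) (k := n) fun t u h => ?_)
    have h1 : blockIndex t n = blockIndex u n := dependsOn_blockIndex n h
    have hle := blockIndex_le u n
    have h2 : blockIndex t (blockIndex u n) = blockIndex u (blockIndex u n) :=
      dependsOn_blockIndex _ fun i hi => h i (le_trans hi hle)
    have h3 := h _ ((blockIndex_le u (blockIndex u n)).trans hle)
    dsimp only
    rw [h1, h2, h3]
  · rw [norm_mul, norm_letterSign, mul_one, norm_pow]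
    exact pow_le_one₀ (norm_nonneg _) hr.le
  · filter_upwards [ae_frequently_eq_two hT hT12 hp0 hp1] with ω hω
    refine squeeze_zero_norm (fun n => ?_) ((tendsto_pow_atTop_nhds_zero_of_lt_one
      (abs_nonneg _) hr).comp (tendsto_blockIndex_sub (fun i => hT12 i ω) hω))
    rw [norm_mul, norm_letterSign, mul_one, norm_pow]
    rfl

theorem tendsto_measureReal_directedSeq_eq_one
    (hT : IsMarkovChain P {1, 2} (flipTransition p) T)
    (hT12 : ∀ n ω, T n ω = 1 ∨ T n ω = 2) (hp0 : 0 < p) (hp1 : p < 1) :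
    Tendsto (fun n => P.real {ω | directedSeq (fun k => T k ω) n = 1}) atTop (𝓝 (1 / 2)) := by
  -- The probability of the letter 1 is `(1 + E) / 2`, where `E` is the expected sign.
  have h := ((tendsto_integral_letterSign_directedSeq hT hT12 hp0 hp1).const_add 1).div_const 2
  rw [add_zero] at h
  refine h.congr fun n => ?_
  have hm : MeasurableSet {ω | directedSeq (fun k => T k ω) n = 1} :=
    measurable_of_dependsOn hT.measurable (dependsOn_directedSeq n) (measurableSet_singleton 1)
  have e : ∀ ω, letterSign (directedSeq (fun i => T i ω) n) =
      2 * Set.indicator {ω | directedSeq (fun k => T k ω) n = 1} 1 ω - 1 := fun ω => by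
    by_cases h : directedSeq (fun k => T k ω) n = 1 <;> simp [letterSign, h] <;> norm_num
  have hi : Integrable (Set.indicator {ω | directedSeq (fun k => T k ω) n = 1} (1 : Ω → ℝ)) P :=
    (integrable_const (1 : ℝ)).indicator hm
  simp_rw [e]
  rw [integral_sub (hi.const_mul 2) (integrable_const _), integral_const_mul,
    integral_indicator_one hm]
  simp

end Chain

end DirectedSequence

/-! ### Reduction to a chain with values in `{1, 2}` everywhere -/

theorem mainTheorem3 {Ω : Type*} [MeasurableSpace Ω] (P : Measure Ω) [IsProbabilityMeasure P]
    (p : ℝ) (hp0 : 0 < p) (hp1 : p < 1) (T : ℕ → Ω → ℕ)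
    (hT : DirectedSequence.IsMarkovChain P {1, 2} (DirectedSequence.flipTransition p) T)
    (hT0 : ∀ᵐ ω ∂P, T 0 ω = 1) :
    Tendsto (fun n : ℕ => P.real {ω | DirectedSequence.directedSeq (fun k => T k ω) n = 1})
      atTop (𝓝 (1 / 2)) := by
  -- Letters lie in `{1, 2}` only almost surely; replacing stray values by 1 changes the chain on a
  -- null set and makes the pointwise combinatorics available everywhere.
  have hae : ∀ n, T n =ᵐ[P] fun ω => if T n ω = 2 then 2 else 1 := fun n => by
    filter_upwards [hT.mem_alphabet n] with ω hω
    rcases hω with h | h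
    · simp [h]
    · rw [Set.mem_singleton_iff] at h
      simp [h]
  have hU := hT.congr (U := fun n ω => if T n ω = 2 then 2 else 1)
    (fun n => (Measurable.of_discrete (f := fun a : ℕ => if a = 2 then 2 else 1)).comp
      (hT.measurable n)) hae
  refine (DirectedSequence.tendsto_measureReal_directedSeq_eq_one hU
    (fun n ω => by split_ifs <;> simp) hp0 hp1).congr fun n => ?_
  refine measureReal_congr (eventuallyEq_set.2 ?_)
  filter_upwards [ae_all_iff.2 hae] with ω hω
  have : (fun k => if T k ω = 2 then 2 else 1) = fun k => T k ω := funext fun k => (hω k).symm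
  simp only [this]
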